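/- **Setting.** Let $n,m,k\in\mathbb N$, let $C,A_1,\dots,A_m$ be real symmetric $n\times n$ matrices and $b\in\mathbb R^m$ with $b\neq 0$. Write $A\bullet X=\operatorname{tr}(X^TA)$, $\mathcal A(\lambda)=\sum_{i=1}^m\lambda_iA_i$, let $\|x\|_0$ be the number of nonzero entries of $x$, and let $\operatorname{diag}X$ be the matrix that keeps only the diagonal entries of $X$. The matrices $A_i$ and the vector $b$ are fixed, and $C$ varies. Consider the sparse QCQP $$(P)\quad \min_{x\in\mathbb R^n}\ x^TCx\quad\text{s.t.}\quad \|x\|_0\le k,\ \ x^TA_ix=b_i\ (i=1,\dots,m),$$ its semidefinite relaxation $$(Q)\quad \min_{X=X^T}\ C\bullet X\quad\text{s.t.}\quad A_i\bullet X=b_i\ (i=1,\dots,m),\ \ k\operatorname{diag}X\succeq X\succeq 0,$$ and the dual problem $$(D)\quad \max_{\lambda\in\mathbb R^m,\ Z=Z^T}\ \lambda\cdot b\quad\text{s.t.}\quad C-\mathcal A(\lambda)-(k\operatorname{diag}Z-Z)\succeq 0,\ \ Z\succeq 0 .$$ The relaxation $(Q)$ is *exact* for the objective $C$ if it has an optimal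 solution and every optimal solution of $(Q)$ is of the form $xx^T$ with $\|x\|_0\le k$; then $\operatorname{val}(Q)=\operatorname{val}(P)$. For $\bar x$ feasible for $(P)$ put $S=\{i:\bar x_i\ne0\}$, identify $\mathbb R^S$ with $\{x\in\mathbb R^n: x_i=0\ \forall i\notin S\}$, let $g_S:\mathbb R^S\to\mathbb R^m$, $g_S(x)=(x^TA_ix-b_i)_{i}$, and $\mathbf X_S=\{x\in\mathbb R^S: g_S(x)=0\}$. The *Abadie constraint qualification* holds at $\bar x$ for $\mathbf X_S$ if $\mathbf X_S$ is a smooth submanifold of $\mathbb R^S$ near $\bar x$ and the rank of the Jacobian of $g_S$ at $\bar x$ equals the codimension of $\mathbf X_S$ in $\mathbb R^S$ at $\bar x$. **Theorem.** Let $\bar C$ be a symmetric matrix such that, for the objective $\bar C$, $\operatorname{val}(D)=\operatorname{val}(Q)=\operatorname{val}(P)$. Let $\bar x$ be optimal for $(P)$ and $(\bar\lambda,\bar Z)$ be optimal for $(D)$, both for the objective $\bar C$. Suppose that (a) $\bar x$ has exactly $k$ nonzero entries; (b) the Abadie constraint qualification holds at $\bar x$ for $\mathbf X_{S}$, where $S$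 is the support of $\bar x$; (c) $\bar Z=0$; (d) $\bar C-\mathcal A(\bar\lambda)$ has corank one (rank $n-1$). Then $(Q)$ is locally stable near $\bar C$: there is a neighborhood of $\bar C$ in the space of symmetric $n\times n$ matrices such that, for every $C$ in it, $(Q)$ is exact, and hence $\operatorname{val}(Q)=\operatorname{val}(P)$. -/

import Mathlib

open scoped Matrix ContDiff Topology

noncomputable section

namespace SparseQCQP

/-- The trace inner product `A • X = tr (Xᵀ A)`. -/
def trInner {n : ℕ} (A X : Matrix (Fin n) (Fin n) ℝ) : ℝ := (Xᵀ * A).trace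

/-- The quadratic form `xᵀ C x`. -/
def quad {n : ℕ} (C : Matrix (Fin n) (Fin n) ℝ) (x : Fin n → ℝ) : ℝ := x ⬝ᵥ (C *ᵥ x)

/-- `diag X`: the matrix that keeps only the diagonal entries of `X`. -/
def diagPart {n : ℕ} (X : Matrix (Fin n) (Fin n) ℝ) : Matrix (Fin n) (Fin n) ℝ :=
  Matrix.diagonal X.diag

/-- The `k`-spartrahedron: symmetric `X` with `k diag X ⪰ X ⪰ 0`. -/
def spartrahedron (n k : ℕ) : Set (Matrix (Fin n) (Fin n) ℝ) :=
  {X | X.PosSemidef ∧ ((k : ℝ) • diagPart X - X).PosSemidef}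

/-- The set `Q_{n,k}` of matrices `x xᵀ` with `‖x‖₀ ≤ k`
(`hammingNorm x` is the number of nonzero entries of `x`). -/
def sparseRankOne (n k : ℕ) : Set (Matrix (Fin n) (Fin n) ℝ) :=
  {X | ∃ x : Fin n → ℝ, hammingNorm x ≤ k ∧ X = Matrix.vecMulVec x x}

/-- The linear map `𝒜(λ) = ∑ i, λ i • A i`. -/
def calA {n m : ℕ} (A : Fin m → Matrix (Fin n) (Fin n) ℝ) (l : Fin m → ℝ) :
    Matrix (Fin n) (Fin n) ℝ := ∑ i, l i • A i

/-! ### The sparse QCQP (P), its relaxation (Q), and the dual (D) -/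

/-- Feasible set of (P). -/
def feasP {n m : ℕ} (k : ℕ) (A : Fin m → Matrix (Fin n) (Fin n) ℝ) (b : Fin m → ℝ) :
    Set (Fin n → ℝ) :=
  {x | hammingNorm x ≤ k ∧ ∀ i, quad (A i) x = b i}

/-- `x` is optimal for (P). -/
def IsOptP {n m : ℕ} (k : ℕ) (A : Fin m → Matrix (Fin n) (Fin n) ℝ) (b : Fin m → ℝ)
    (C : Matrix (Fin n) (Fin n) ℝ) (x : Fin n → ℝ) : Prop :=
  x ∈ feasP k A b ∧ ∀ y ∈ feasP k A b, quad C x ≤ quad C y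

/-- Optimal value of (P) in the extended reals. -/
def valP {n m : ℕ} (k : ℕ) (A : Fin m → Matrix (Fin n) (Fin n) ℝ) (b : Fin m → ℝ)
    (C : Matrix (Fin n) (Fin n) ℝ) : EReal :=
  ⨅ x ∈ feasP k A b, ((quad C x : ℝ) : EReal)

/-- Feasible set of (Q). -/
def feasQ {n m : ℕ} (k : ℕ) (A : Fin m → Matrix (Fin n) (Fin n) ℝ) (b : Fin m → ℝ) :
    Set (Matrix (Fin n) (Fin n) ℝ) :=
  {X | X ∈ spartrahedron n k ∧ ∀ i, trInner (A i) X = b i}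

/-- `X` is optimal for (Q). -/
def IsOptQ {n m : ℕ} (k : ℕ) (A : Fin m → Matrix (Fin n) (Fin n) ℝ) (b : Fin m → ℝ)
    (C : Matrix (Fin n) (Fin n) ℝ) (X : Matrix (Fin n) (Fin n) ℝ) : Prop :=
  X ∈ feasQ k A b ∧ ∀ Y ∈ feasQ k A b, trInner C X ≤ trInner C Y

/-- Optimal value of (Q) in the extended reals. -/
def valQ {n m : ℕ} (k : ℕ) (A : Fin m → Matrix (Fin n) (Fin n) ℝ) (b : Fin m → ℝ)
    (C : Matrix (Fin n) (Fin n) ℝ) : EReal :=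
  ⨅ X ∈ feasQ k A b, ((trInner C X : ℝ) : EReal)

/-- Feasible set of (D): pairs `(λ, Z)` with `Z ⪰ 0` and `C - 𝒜(λ) - (k diag Z - Z) ⪰ 0`. -/
def feasD {n m : ℕ} (k : ℕ) (A : Fin m → Matrix (Fin n) (Fin n) ℝ)
    (C : Matrix (Fin n) (Fin n) ℝ) : Set ((Fin m → ℝ) × Matrix (Fin n) (Fin n) ℝ) :=
  {q | q.2.PosSemidef ∧ (C - calA A q.1 - ((k : ℝ) • diagPart q.2 - q.2)).PosSemidef}

/-- `(λ, Z)` is optimal for (D). -/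
def IsOptD {n m : ℕ} (k : ℕ) (A : Fin m → Matrix (Fin n) (Fin n) ℝ) (b : Fin m → ℝ)
    (C : Matrix (Fin n) (Fin n) ℝ) (l : Fin m → ℝ) (Z : Matrix (Fin n) (Fin n) ℝ) : Prop :=
  (l, Z) ∈ feasD k A C ∧ ∀ q ∈ feasD k A C, q.1 ⬝ᵥ b ≤ l ⬝ᵥ b

/-- Optimal value of (D) in the extended reals. -/
def valD {n m : ℕ} (k : ℕ) (A : Fin m → Matrix (Fin n) (Fin n) ℝ) (b : Fin m → ℝ)
    (C : Matrix (Fin n) (Fin n) ℝ) : EReal :=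
  ⨆ q ∈ feasD k A C, ((q.1 ⬝ᵥ b : ℝ) : EReal)

/-- (Q) is exact for the objective `C`: it has an optimal solution, and every optimal solution
is of the form `x xᵀ` with `‖x‖₀ ≤ k`. -/
def IsExact {n m : ℕ} (k : ℕ) (A : Fin m → Matrix (Fin n) (Fin n) ℝ) (b : Fin m → ℝ)
    (C : Matrix (Fin n) (Fin n) ℝ) : Prop :=
  (∃ X, IsOptQ k A b C X) ∧ ∀ X, IsOptQ k A b C X → X ∈ sparseRankOne n k

/-- (Q) is locally stable near `C₀`: for every symmetric `C` in a neighbourhood of `C₀`,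
(Q) is exact and `val(Q) = val(P)`. -/
def LocallyStable {n m : ℕ} (k : ℕ) (A : Fin m → Matrix (Fin n) (Fin n) ℝ) (b : Fin m → ℝ)
    (C₀ : Matrix (Fin n) (Fin n) ℝ) : Prop :=
  ∀ᶠ C in 𝓝[{C : Matrix (Fin n) (Fin n) ℝ | C.IsSymm}] C₀,
    IsExact k A b C ∧ valQ k A b C = valP k A b C

/-! ### The Abadie constraint qualification -/

/-- The support of a vector. -/
def supp {n : ℕ} (x : Fin n → ℝ) : Finset (Fin n) := Finset.univ.filter fun i => x i ≠ 0

/-- The constraint map `g(x) = (xᵀ Aᵢ x - bᵢ)ᵢ`. -/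
def constraintMap {n m : ℕ} (A : Fin m → Matrix (Fin n) (Fin n) ℝ) (b : Fin m → ℝ)
    (x : Fin n → ℝ) : Fin m → ℝ := fun i => quad (A i) x - b i

/-- The support-restricted variety `{x : g(x) = 0, xᵢ = 0 for i ∉ S}`. -/
def suppVariety {n m : ℕ} (A : Fin m → Matrix (Fin n) (Fin n) ℝ) (b : Fin m → ℝ)
    (S : Finset (Fin n)) : Set (Fin n → ℝ) :=
  {x | constraintMap A b x = 0 ∧ ∀ i ∉ S, x i = 0}

/-- The inclusion `ℝ^S → ℝ^n` (extension by zero), whose image is the coordinate subspace of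
vectors supported in `S`. -/
def extendZero {n : ℕ} (S : Finset (Fin n)) (y : S → ℝ) : Fin n → ℝ :=
  fun i => if h : i ∈ S then y ⟨i, h⟩ else 0

/-- The subvector `x_S`. -/
def restrictTo {n : ℕ} (S : Finset (Fin n)) (x : Fin n → ℝ) : S → ℝ := fun i => x i

/-- Near its point `p`, the set `M` is a smooth (embedded) submanifold of codimension `c`: on an
open neighbourhood of `p` it is the zero set of `c` smooth functions whose differentials at `p`
are linearly independent. -/
def IsSmoothManifoldNear {E : Type*} [NormedAddCommGroup E] [NormedSpace ℝ E]
    (M : Set E) (p : E) (c : ℕ) : Prop :=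
  p ∈ M ∧ ∃ (U : Set E) (φ : E → (Fin c → ℝ)), IsOpen U ∧ p ∈ U ∧ ContDiffOn ℝ ∞ φ U ∧
    Function.Surjective (fderiv ℝ φ p) ∧ M ∩ U = {x ∈ U | φ x = 0}

/-- The Abadie constraint qualification at `x` for the support-restricted variety of
`S = supp x`, everything being viewed inside the coordinate subspace `ℝ^S`: the variety is a
smooth manifold near `x_S`, and the rank of the Jacobian of `g_S = g|_{ℝ^S}` at `x_S` equals
its codimension in `ℝ^S`. -/
def ACQ {n m : ℕ} (A : Fin m → Matrix (Fin n) (Fin n) ℝ) (b : Fin m → ℝ)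
    (x : Fin n → ℝ) : Prop :=
  ∃ c : ℕ,
    IsSmoothManifoldNear (extendZero (supp x) ⁻¹' suppVariety A b (supp x))
      (restrictTo (supp x) x) c ∧
    (fderiv ℝ (fun y => constraintMap A b (extendZero (supp x) y))
      (restrictTo (supp x) x)).rank = c

end SparseQCQP

end

/-!
Write `H₀ = Cbar - 𝒜(lbar)`. Since `Zbar = 0`, dual feasibility says that `H₀` is positive
semidefinite, and strong duality gives `xbarᵀ H₀ xbar = 0`; with corank one, the kernel of `H₀` is
the line through `xbar`. The theorem follows once, for every symmetric `C` near `Cbar`, there are a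
feasible point `x` of (P) and a dual pair `(l, Z)`, close to `xbar` and `(lbar, 0)`, such that the
slack matrix `H = C - 𝒜(l) - (k diag Z - Z)` annihilates `x` and `Z` is complementary to `x xᵀ`.
Indeed `H` is then close to `H₀`, hence positive semidefinite with kernel spanned by `x`
(`eventually_posSemidef_of_mulVec_eq_zero`), and weak duality shows that every solution of (Q) is a
multiple of `x xᵀ`, the multiple being one because `b ≠ 0` (`isExact_of_certificate`).

The point `x` minimizes the Lagrangian `uᵀ (C - 𝒜(lbar)) u` over the vectors `u` near `xbar` that
satisfy the constraints and are supported in `S = supp xbar`. At `C = Cbar` the only minimizers are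
`± xbar`, so compactness gives `x → xbar` as `C → Cbar` (`exists_tendsto_localMin`). Multipliers at
`x` come from the constraint qualification: the Lagrange multiplier theorem, for the functions that
define the manifold near `xbar`, applies to the Lagrangian and also to each constraint, which is
constant on the manifold. By equality of dimensions the constraint gradients span the same space as
the differentials of the defining functions, at all points of the manifold near `xbar`
(`exists_gradients_spanning_near`). The Lagrangian has small gradient at `x`, and its coefficients
in a family of gradients that stays independent are small too (`tendsto_coeff_of_tendsto_sum`).

This makes `ρ = (C - 𝒜(l)) x` vanish on `S`, but off `S` it is only small. It is cancelled by
`Z = z zᵀ`, where `z i = t / x i` on `S` and `z i = -ρ i / (k t)` off `S`: as `xbar` has exactly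
`k` nonzero entries, `(k diag Z - Z) x = ρ` (`sparsityVec_spec`), and the choice `t = √‖ρ‖` makes
`Z` small (`tendsto_sparsityVec`).
-/

namespace SparseQCQP

/-! ### Quadratic forms and trace inner products -/

lemma quad_add {n : ℕ} (M N : Matrix (Fin n) (Fin n) ℝ) (x : Fin n → ℝ) :
    quad (M + N) x = quad M x + quad N x := by
  simp [quad, Matrix.add_mulVec, dotProduct_add]

lemma quad_sub {n : ℕ} (M N : Matrix (Fin n) (Fin n) ℝ) (x : Fin n → ℝ) :
    quad (M - N) x = quad M x - quad N x := by
  simp [quad, Matrix.sub_mulVec, dotProduct_sub]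

lemma quad_calA {n m : ℕ} (A : Fin m → Matrix (Fin n) (Fin n) ℝ) (l : Fin m → ℝ)
    (x : Fin n → ℝ) : quad (calA A l) x = ∑ i, l i * quad (A i) x := by
  simp [quad, calA, Matrix.sum_mulVec, Matrix.smul_mulVec, dotProduct_sum, dotProduct_smul]

lemma quad_smul {n : ℕ} (M : Matrix (Fin n) (Fin n) ℝ) (c : ℝ) (x : Fin n → ℝ) :
    quad M (c • x) = c ^ 2 * quad M x := by
  simp [quad, Matrix.mulVec_smul]
  ring

lemma quad_vecMulVec {n : ℕ} (z x : Fin n → ℝ) :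
    quad (Matrix.vecMulVec z z) x = (z ⬝ᵥ x) ^ 2 := by
  simp only [quad, Matrix.vecMulVec_mulVec, dotProduct_smul]
  simp [dotProduct_comm x z, sq]

lemma quad_diagPart {n : ℕ} (M : Matrix (Fin n) (Fin n) ℝ) (x : Fin n → ℝ) :
    quad (diagPart M) x = ∑ i, M i i * x i ^ 2 := by
  simp only [quad, diagPart, dotProduct, Matrix.mulVec_diagonal, Matrix.diag_apply]
  exact Finset.sum_congr rfl fun i _ => by ring

lemma _root_.Matrix.PosSemidef.quad_nonneg {n : ℕ} {M : Matrix (Fin n) (Fin n) ℝ}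
    (hM : M.PosSemidef) (x : Fin n → ℝ) : 0 ≤ quad M x := by
  simpa [quad] using hM.dotProduct_mulVec_nonneg x

lemma _root_.Matrix.PosSemidef.quad_eq_zero_iff {n : ℕ} {M : Matrix (Fin n) (Fin n) ℝ}
    (hM : M.PosSemidef) (x : Fin n → ℝ) : quad M x = 0 ↔ M *ᵥ x = 0 := by
  simpa [quad] using hM.dotProduct_mulVec_zero_iff x

lemma posSemidef_of_quad_nonneg {n : ℕ} {M : Matrix (Fin n) (Fin n) ℝ} (hM : M.IsSymm)
    (h : ∀ x, 0 ≤ quad M x) : M.PosSemidef :=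
  Matrix.PosSemidef.of_dotProduct_mulVec_nonneg (by simpa [Matrix.IsHermitian] using hM.eq)
    (by simpa [quad] using h)

lemma trInner_add {n : ℕ} (M N X : Matrix (Fin n) (Fin n) ℝ) :
    trInner (M + N) X = trInner M X + trInner N X := by
  simp [trInner, mul_add]

lemma trInner_calA {n m : ℕ} (A : Fin m → Matrix (Fin n) (Fin n) ℝ) (l : Fin m → ℝ)
    (X : Matrix (Fin n) (Fin n) ℝ) : trInner (calA A l) X = ∑ i, l i * trInner (A i) X := by
  simp [trInner, calA, Finset.mul_sum, Matrix.trace_sum]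

lemma trInner_eq_sum {n : ℕ} (M X : Matrix (Fin n) (Fin n) ℝ) :
    trInner M X = ∑ i, ∑ j, X i j * M i j := by
  simp only [trInner, Matrix.trace, Matrix.diag_apply, Matrix.mul_apply, Matrix.transpose_apply]
  exact Finset.sum_comm

/-- The operator `X ↦ k diag X - X` is self-adjoint for the trace inner product. -/
lemma trInner_diagPart_sub_comm {n : ℕ} (k : ℝ) (Z X : Matrix (Fin n) (Fin n) ℝ) :
    trInner (k • diagPart Z - Z) X = trInner (k • diagPart X - X) Z := by
  simp only [trInner_eq_sum, Matrix.sub_apply, Matrix.smul_apply, smul_eq_mul, diagPart,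
    Matrix.diagonal_apply, Matrix.diag_apply, mul_sub, Finset.sum_sub_distrib, mul_ite, mul_zero,
    Finset.sum_ite_eq, Finset.mem_univ, if_true]
  congr 1
  · exact Finset.sum_congr rfl fun i _ => by ring
  · exact Finset.sum_congr rfl fun i _ => Finset.sum_congr rfl fun j _ => by ring

lemma trInner_vecMulVec {n : ℕ} (M : Matrix (Fin n) (Fin n) ℝ) (x : Fin n → ℝ) :
    trInner M (Matrix.vecMulVec x x) = quad M x := by
  simp only [trInner_eq_sum, quad, dotProduct, Matrix.mulVec, Matrix.vecMulVec_apply,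
    Finset.mul_sum]
  exact Finset.sum_congr rfl fun i _ => Finset.sum_congr rfl fun j _ => by ring

lemma trInner_sum_vecMulVec {n : ℕ} {ι : Type*} [Fintype ι] (M : Matrix (Fin n) (Fin n) ℝ)
    (B : ι → Fin n → ℝ) :
    trInner M (∑ l, Matrix.vecMulVec (B l) (B l)) = ∑ l, quad M (B l) := by
  simp only [← trInner_vecMulVec, trInner, Matrix.transpose_sum, Finset.sum_mul, Matrix.trace_sum]

open scoped MatrixOrder in
lemma _root_.Matrix.PosSemidef.exists_eq_sum_vecMulVec {n : ℕ} {Y : Matrix (Fin n) (Fin n) ℝ}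
    (hY : Y.PosSemidef) : ∃ B : Fin n → Fin n → ℝ, Y = ∑ l, Matrix.vecMulVec (B l) (B l) := by
  obtain ⟨B, rfl⟩ := CStarAlgebra.nonneg_iff_eq_star_mul_self.mp hY.nonneg
  refine ⟨B, ?_⟩
  ext i j
  simp [Matrix.mul_apply, Matrix.sum_apply, Matrix.vecMulVec_apply]

lemma trInner_nonneg {n : ℕ} {M Y : Matrix (Fin n) (Fin n) ℝ} (hM : M.PosSemidef)
    (hY : Y.PosSemidef) : 0 ≤ trInner M Y := by
  obtain ⟨B, rfl⟩ := hY.exists_eq_sum_vecMulVec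
  rw [trInner_sum_vecMulVec]
  exact Finset.sum_nonneg fun l _ => hM.quad_nonneg _

/-- A positive semidefinite `Y` complementary to a positive semidefinite `M` whose kernel is
spanned by `x` is a multiple of `x xᵀ`. -/
lemma exists_eq_smul_vecMulVec_of_trInner_eq_zero {n : ℕ} {M Y : Matrix (Fin n) (Fin n) ℝ}
    (hM : M.PosSemidef) (hY : Y.PosSemidef) (h0 : trInner M Y = 0) {x : Fin n → ℝ}
    (hker : ∀ v, M *ᵥ v = 0 → ∃ s : ℝ, s • x = v) :
    ∃ s : ℝ, Y = s • Matrix.vecMulVec x x := by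
  obtain ⟨B, rfl⟩ := hY.exists_eq_sum_vecMulVec
  rw [trInner_sum_vecMulVec, Finset.sum_eq_zero_iff_of_nonneg fun l _ => hM.quad_nonneg _] at h0
  have h1 : ∀ l, ∃ s : ℝ, s • x = B l := fun l =>
    hker _ ((hM.quad_eq_zero_iff _).mp (h0 l (Finset.mem_univ l)))
  choose s hs using h1
  refine ⟨∑ l, s l ^ 2, ?_⟩
  rw [Finset.sum_smul]
  refine Finset.sum_congr rfl fun l _ => ?_
  rw [← hs l, Matrix.smul_vecMulVec, Matrix.vecMulVec_smul, smul_smul, sq]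

/-! ### Optimality certificates for the relaxation -/

/-- If `x` has at most `k` nonzero entries, the Cauchy-Schwarz inequality gives
`k diag (x xᵀ) ⪰ x xᵀ`. -/
lemma vecMulVec_mem_spartrahedron {n k : ℕ} {x : Fin n → ℝ} (hx : hammingNorm x ≤ k) :
    Matrix.vecMulVec x x ∈ spartrahedron n k := by
  have hsymm : (Matrix.vecMulVec x x).IsSymm := by
    ext i j; simp [Matrix.vecMulVec_apply, mul_comm]
  refine ⟨posSemidef_of_quad_nonneg hsymm fun v => ?_, posSemidef_of_quad_nonneg ?_ fun v => ?_⟩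
  · rw [quad_vecMulVec]; positivity
  · exact (Matrix.IsSymm.smul (Matrix.isSymm_diagonal _) _).sub hsymm
  · have h1 : (x ⬝ᵥ v) ^ 2 ≤ (k : ℝ) * ∑ i, x i * x i * v i ^ 2 := by
      have h2 : x ⬝ᵥ v = ∑ i with x i ≠ 0, x i * v i := by
        rw [Finset.sum_filter_of_ne]
        · rfl
        · intro i _ h h0
          simp [h0] at h
      have h3 : (∑ i with x i ≠ 0, x i * v i) ^ 2
          ≤ (hammingNorm x : ℝ) * ∑ i with x i ≠ 0, (x i * v i) ^ 2 :=
        sq_sum_le_card_mul_sum_sq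
      have h4 : ∑ i with x i ≠ 0, (x i * v i) ^ 2 ≤ ∑ i, x i * x i * v i ^ 2 := by
        refine (Finset.sum_le_sum_of_subset_of_nonneg (Finset.filter_subset _ _)
          fun i _ _ => by positivity).trans (Finset.sum_le_sum fun i _ => le_of_eq (by ring))
      rw [h2]
      refine h3.trans (mul_le_mul (by exact_mod_cast hx) h4 ?_ (by positivity))
      exact Finset.sum_nonneg fun i _ => by positivity
    have h5 : quad ((k : ℝ) • diagPart (Matrix.vecMulVec x x)) v
        = k * quad (diagPart (Matrix.vecMulVec x x)) v := by
      simp [quad, Matrix.smul_mulVec]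
    rw [quad_sub, h5, quad_diagPart, quad_vecMulVec]
    simpa [Matrix.vecMulVec_apply] using h1

lemma vecMulVec_mem_feasQ {n m k : ℕ} {A : Fin m → Matrix (Fin n) (Fin n) ℝ} {b : Fin m → ℝ}
    {x : Fin n → ℝ} (hx : x ∈ feasP k A b) : Matrix.vecMulVec x x ∈ feasQ k A b :=
  ⟨vecMulVec_mem_spartrahedron hx.1, fun i => by rw [trInner_vecMulVec, hx.2 i]⟩

/-- A feasible point `x` of (P) and a dual feasible pair `(l, Z)`, complementary to `x xᵀ`, whose
slack matrix has kernel spanned by `x`, certify that `x xᵀ` is the unique solution of (Q). -/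
theorem isExact_of_certificate {n m k : ℕ} {A : Fin m → Matrix (Fin n) (Fin n) ℝ}
    {b : Fin m → ℝ} (hb : ∃ i, b i ≠ 0) {C : Matrix (Fin n) (Fin n) ℝ} {x : Fin n → ℝ}
    (hx : x ∈ feasP k A b) {l : Fin m → ℝ} {Z : Matrix (Fin n) (Fin n) ℝ}
    (hlZ : (l, Z) ∈ feasD k A C)
    (hcompl : quad ((k : ℝ) • diagPart Z - Z) x = 0)
    (hHx : (C - calA A l - ((k : ℝ) • diagPart Z - Z)) *ᵥ x = 0)
    (hker : ∀ v, (C - calA A l - ((k : ℝ) • diagPart Z - Z)) *ᵥ v = 0 → ∃ s : ℝ, s • x = v) :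
    IsExact k A b C ∧ valQ k A b C = valP k A b C := by
  obtain ⟨hZ, hH⟩ := hlZ
  simp only at hZ hH
  set W := (k : ℝ) • diagPart Z - Z with hW
  set H := C - calA A l - W with hHdef
  have hCeq : C = calA A l + W + H := by rw [hHdef]; abel
  have hval : ∀ Y ∈ feasQ k A b,
      trInner C Y = ∑ i, l i * b i + trInner ((k : ℝ) • diagPart Y - Y) Z + trInner H Y := by
    intro Y hY
    have h1 : trInner W Y = trInner ((k : ℝ) • diagPart Y - Y) Z := trInner_diagPart_sub_comm _ _ _
    rw [hCeq, trInner_add, trInner_add, trInner_calA, h1]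
    simp only [hY.2]
  have hlow : ∀ Y ∈ feasQ k A b, ∑ i, l i * b i ≤ trInner C Y := by
    intro Y hY
    rw [hval Y hY]
    have := trInner_nonneg hY.1.2 hZ
    have := trInner_nonneg hH hY.1.1
    linarith
  have hXfeas := vecMulVec_mem_feasQ hx
  have hXval : quad C x = ∑ i, l i * b i := by
    have hq : quad H x = 0 := by simp [quad, hHx]
    rw [hCeq, quad_add, quad_add, hcompl, hq, quad_calA]
    simp [hx.2]
  have hXopt : IsOptQ k A b C (Matrix.vecMulVec x x) := by
    refine ⟨hXfeas, fun Y hY => ?_⟩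
    rw [trInner_vecMulVec, hXval]
    exact hlow Y hY
  refine ⟨⟨⟨_, hXopt⟩, fun Y hY => ?_⟩, ?_⟩
  · have h1 := hY.2 _ hXfeas
    rw [trInner_vecMulVec, hXval, hval Y hY.1] at h1
    have h2 := trInner_nonneg hY.1.1.2 hZ
    have h3 := trInner_nonneg hH hY.1.1.1
    obtain ⟨s, rfl⟩ := exists_eq_smul_vecMulVec_of_trInner_eq_zero hH hY.1.1.1
      (le_antisymm (by linarith) h3) hker
    -- A constraint with nonzero right-hand side forces the multiple to be one.
    obtain ⟨i, hi⟩ := hb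
    have h4 : s * b i = b i := by
      have h5 := hY.1.2 i
      have h6 : trInner (A i) (s • Matrix.vecMulVec x x) = s * b i := by
        rw [← hx.2 i, ← trInner_vecMulVec]
        simp [trInner]
      rw [← h6, h5]
    have hs : s = 1 := by
      have : (s - 1) * b i = 0 := by linarith
      rcases mul_eq_zero.mp this with h | h
      · linarith
      · exact absurd h hi
    exact ⟨x, hx.1, by rw [hs, one_smul]⟩
  · refine le_antisymm ?_ ?_
    · refine le_iInf₂ fun y hy => ?_
      refine (iInf₂_le _ (vecMulVec_mem_feasQ hy)).trans (le_of_eq ?_)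
      rw [trInner_vecMulVec]
    · refine (iInf₂_le x hx).trans (le_iInf₂ fun Y hY => ?_)
      rw [hXval]
      exact EReal.coe_le_coe (hlow Y hY)

/-! ### Perturbation of positive semidefinite matrices of corank one -/

lemma continuous_quad {n : ℕ} :
    Continuous fun p : Matrix (Fin n) (Fin n) ℝ × (Fin n → ℝ) => quad p.1 p.2 :=
  continuous_snd.dotProduct (continuous_fst.matrix_mulVec continuous_snd)

/-- Positivity of the quadratic form off the origin is an open condition: by homogeneity it is
enough to test it on the compact unit sphere. -/
lemma eventually_quad_pos {n : ℕ} {M₀ : Matrix (Fin n) (Fin n) ℝ}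
    (h : ∀ v, v ≠ 0 → 0 < quad M₀ v) : ∀ᶠ M in 𝓝 M₀, ∀ v, v ≠ 0 → 0 < quad M v := by
  have h1 : ∀ᶠ M in 𝓝 M₀, ∀ v ∈ Metric.sphere (0 : Fin n → ℝ) 1, 0 < quad M v := by
    refine (isCompact_sphere _ _).eventually_forall_of_forall_eventually fun v hv => ?_
    have hv0 : v ≠ 0 := by
      rintro rfl
      simp at hv
    exact continuous_quad.continuousAt.eventually (lt_mem_nhds (h v hv0))
  filter_upwards [h1] with M hM v hv
  have hn : 0 < ‖v‖ := norm_pos_iff.mpr hv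
  have h2 := hM (‖v‖⁻¹ • v) (by
    rw [mem_sphere_zero_iff_norm, norm_smul, norm_inv, norm_norm, inv_mul_cancel₀ hn.ne'])
  rw [quad_smul] at h2
  exact pos_of_mul_pos_right h2 (by positivity)

/-- A symmetric perturbation of a positive semidefinite matrix with one-dimensional kernel stays
positive semidefinite with one-dimensional kernel, as soon as it annihilates a perturbation of the
kernel vector: adding `x xᵀ` reduces this to the openness of positive definiteness. -/
lemma eventually_posSemidef_of_mulVec_eq_zero {α : Type*} {F : Filter α} {n : ℕ}
    {M : α → Matrix (Fin n) (Fin n) ℝ} {M₀ : Matrix (Fin n) (Fin n) ℝ}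
    {x : α → Fin n → ℝ} {x₀ : Fin n → ℝ}
    (hM : Filter.Tendsto M F (𝓝 M₀)) (hx : Filter.Tendsto x F (𝓝 x₀)) (hM₀ : M₀.PosSemidef)
    (hker : ∀ v, M₀ *ᵥ v = 0 → ∃ s : ℝ, s • x₀ = v)
    (hsymm : ∀ᶠ a in F, (M a).IsSymm) (hMx : ∀ᶠ a in F, M a *ᵥ x a = 0) :
    ∀ᶠ a in F, (M a).PosSemidef ∧ ∀ v, M a *ᵥ v = 0 → ∃ s : ℝ, s • x a = v := by
  have hpos₀ : ∀ v, v ≠ 0 → 0 < quad (M₀ + Matrix.vecMulVec x₀ x₀) v := by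
    intro v hv
    rw [quad_add, quad_vecMulVec]
    have h1 := hM₀.quad_nonneg v
    rcases h1.lt_or_eq with h2 | h2
    · positivity
    · obtain ⟨s, rfl⟩ := hker v ((hM₀.quad_eq_zero_iff v).mp h2.symm)
      have hs : s ≠ 0 := by rintro rfl; simp at hv
      have hx₀ : x₀ ≠ 0 := by rintro rfl; simp at hv
      have h3 : x₀ ⬝ᵥ x₀ ≠ 0 := by simpa [dotProduct_self_eq_zero] using hx₀
      rw [← h2, zero_add, dotProduct_smul, smul_eq_mul]
      positivity
  have htend : Filter.Tendsto (fun a => M a + Matrix.vecMulVec (x a) (x a)) F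
      (𝓝 (M₀ + Matrix.vecMulVec x₀ x₀)) :=
    hM.add (((continuous_id.matrix_vecMulVec continuous_id).tendsto x₀).comp hx)
  filter_upwards [htend.eventually (eventually_quad_pos hpos₀), hsymm, hMx] with a hpos hs hz
  -- Split `v = α x + w` with `w` orthogonal to `x`.
  have hsplit : ∀ v : Fin n → ℝ, ∃ α : ℝ, ∃ w : Fin n → ℝ, v = α • x a + w ∧ x a ⬝ᵥ w = 0 := by
    intro v
    by_cases hxa : x a ⬝ᵥ x a = 0
    · have : x a = 0 := by simpa [dotProduct_self_eq_zero] using hxa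
      exact ⟨0, v, by simp, by simp [this]⟩
    · refine ⟨(x a ⬝ᵥ v) / (x a ⬝ᵥ x a), v - ((x a ⬝ᵥ v) / (x a ⬝ᵥ x a)) • x a, by simp, ?_⟩
      rw [dotProduct_sub, dotProduct_smul, smul_eq_mul, div_mul_cancel₀ _ hxa, sub_self]
  have hw : ∀ w : Fin n → ℝ, x a ⬝ᵥ w = 0 → w ≠ 0 → 0 < quad (M a) w := by
    intro w hw hw0
    have := hpos w hw0
    rwa [quad_add, quad_vecMulVec, hw, zero_pow two_ne_zero, add_zero] at this
  refine ⟨posSemidef_of_quad_nonneg hs fun v => ?_, fun v hv => ?_⟩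
  · obtain ⟨α, w, rfl, hxw⟩ := hsplit v
    have h1 : quad (M a) (α • x a + w) = quad (M a) w := by
      have h2 : x a ⬝ᵥ (M a *ᵥ w) = 0 := by
        rw [Matrix.dotProduct_mulVec, ← Matrix.mulVec_transpose, hs.eq, hz, zero_dotProduct]
      simp [quad, Matrix.mulVec_add, Matrix.mulVec_smul, hz, add_dotProduct, h2]
    rw [h1]
    by_cases hw0 : w = 0
    · simp [hw0, quad]
    · exact (hw w hxw hw0).le
  · obtain ⟨α, w, rfl, hxw⟩ := hsplit v
    have h1 : M a *ᵥ w = 0 := by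
      simpa [Matrix.mulVec_add, Matrix.mulVec_smul, hz] using hv
    have hw0 : w = 0 := by
      by_contra hw0
      have := hw w hxw hw0
      simp [quad, h1] at this
    exact ⟨α, by simp [hw0]⟩

/-! ### A small multiplier for the sparsity constraint -/

/-- The vector `z` whose square `z zᵀ` serves as multiplier `Z` of the sparsity constraint: it is
`t / xᵢ` on the support of `x`, and off the support it is chosen so that
`(k diag Z - Z) x = ρ`. -/
noncomputable def sparsityVec {n : ℕ} (k : ℕ) (x ρ : Fin n → ℝ) (t : ℝ) : Fin n → ℝ :=
  fun i => if x i = 0 then -(ρ i / (k * t)) else t / x i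

lemma sparsityVec_dotProduct {n k : ℕ} {x : Fin n → ℝ} (hx : hammingNorm x = k)
    (ρ : Fin n → ℝ) (t : ℝ) : sparsityVec k x ρ t ⬝ᵥ x = k * t := by
  have h : ∀ i, sparsityVec k x ρ t i * x i = if x i ≠ 0 then t else 0 := by
    intro i
    by_cases hi : x i = 0 <;> simp [sparsityVec, hi]
  simp only [dotProduct, h, ← Finset.sum_filter, Finset.sum_const, nsmul_eq_mul]
  rw [← hx]
  rfl

lemma sparsityVec_spec {n k : ℕ} (hk : k ≠ 0) {x ρ : Fin n → ℝ} (hx : hammingNorm x = k)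
    (hρ : ∀ i, x i ≠ 0 → ρ i = 0) {t : ℝ} (ht : t = 0 → ρ = 0) :
    ((k : ℝ) • diagPart (Matrix.vecMulVec (sparsityVec k x ρ t) (sparsityVec k x ρ t))
      - Matrix.vecMulVec (sparsityVec k x ρ t) (sparsityVec k x ρ t)) *ᵥ x = ρ := by
  have hk' : (k : ℝ) ≠ 0 := Nat.cast_ne_zero.mpr hk
  ext i
  have h1 := sparsityVec_dotProduct hx ρ t
  simp only [Matrix.sub_mulVec, Matrix.smul_mulVec, Matrix.vecMulVec_mulVec, Pi.sub_apply,
    Pi.smul_apply, diagPart, Matrix.mulVec_diagonal, Matrix.diag_apply, Matrix.vecMulVec_apply,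
    smul_eq_mul, MulOpposite.smul_eq_mul_unop, MulOpposite.unop_op, h1]
  by_cases hi : x i = 0
  · by_cases ht0 : t = 0
    · simp [hi, ht0, ht ht0]
    · simp only [sparsityVec, hi, if_true]
      field_simp
      ring
  · simp only [sparsityVec, hi, if_false, hρ i hi]
    field_simp
    ring

/-- With `t = √‖ρ‖` the vector `sparsityVec` is small together with `ρ`: both `t` and
`‖ρ‖ / t` are of order `√‖ρ‖`. -/
lemma tendsto_sparsityVec {α : Type*} {F : Filter α} {n k : ℕ} (hk : k ≠ 0)
    {x ρ : α → Fin n → ℝ} {x₀ : Fin n → ℝ} (hx : Filter.Tendsto x F (𝓝 x₀))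
    (hsupp : ∀ᶠ a in F, ∀ i, x a i = 0 ↔ x₀ i = 0) (hρ : Filter.Tendsto ρ F (𝓝 0)) :
    Filter.Tendsto (fun a => sparsityVec k (x a) (ρ a) √‖ρ a‖) F (𝓝 0) := by
  have ht : Filter.Tendsto (fun a => √‖ρ a‖) F (𝓝 0) := by
    simpa using hρ.norm.sqrt
  rw [tendsto_pi_nhds] at hx ⊢
  intro i
  by_cases hi : x₀ i = 0
  · refine squeeze_zero_norm' ?_ ht
    filter_upwards [hsupp] with a ha
    have h1 : ‖ρ a i‖ ≤ √‖ρ a‖ * √‖ρ a‖ := by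
      rw [Real.mul_self_sqrt (norm_nonneg _)]
      exact norm_le_pi_norm _ _
    have h2 : (1 : ℝ) ≤ k := by exact_mod_cast Nat.one_le_iff_ne_zero.mpr hk
    simp only [sparsityVec, (ha i).mpr hi, if_true, norm_neg, norm_div, norm_mul,
      Real.norm_natCast, Real.norm_of_nonneg (Real.sqrt_nonneg _)]
    refine div_le_of_le_mul₀ (by positivity) (by positivity) (h1.trans ?_)
    have h3 : 0 ≤ √‖ρ a‖ * √‖ρ a‖ := by positivity
    nlinarith
  · have h1 : Filter.Tendsto (fun a => √‖ρ a‖ / x a i) F (𝓝 0) := by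
      have h := ht.div (hx i) hi
      rwa [zero_div] at h
    refine h1.congr' ?_
    filter_upwards [hsupp] with a ha
    simp [sparsityVec, ha i, hi]

lemma continuous_calA {n m : ℕ} (A : Fin m → Matrix (Fin n) (Fin n) ℝ) :
    Continuous (calA A) :=
  continuous_finsetSum _ fun i _ => (continuous_apply i).smul continuous_const

lemma calA_isSymm {n m : ℕ} {A : Fin m → Matrix (Fin n) (Fin n) ℝ} (hA : ∀ i, (A i).IsSymm)
    (l : Fin m → ℝ) : (calA A l).IsSymm := by
  simp only [Matrix.IsSymm, calA, Matrix.transpose_sum, Matrix.transpose_smul, (hA _).eq]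

/-- Local stability follows from a family of feasible points and multipliers of the problem
restricted to the support of `xbar`, converging to `(xbar, lbar)`: the stationarity defect lives off the
support and tends to zero, and is absorbed by a small multiplier `Z` of the sparsity constraint. -/
theorem locallyStable_of_tendsto {n m k : ℕ} {A : Fin m → Matrix (Fin n) (Fin n) ℝ}
    (hA : ∀ i, (A i).IsSymm) {b : Fin m → ℝ} (hb : ∃ i, b i ≠ 0)
    {Cbar : Matrix (Fin n) (Fin n) ℝ} {xbar : Fin n → ℝ} {lbar : Fin m → ℝ}
    (hk : k ≠ 0) (hcard : hammingNorm xbar = k)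
    (hpsd : (Cbar - calA A lbar).PosSemidef)
    (hHx : (Cbar - calA A lbar) *ᵥ xbar = 0)
    (hker : ∀ v, (Cbar - calA A lbar) *ᵥ v = 0 → ∃ s : ℝ, s • xbar = v)
    {x : Matrix (Fin n) (Fin n) ℝ → Fin n → ℝ} {l : Matrix (Fin n) (Fin n) ℝ → Fin m → ℝ}
    (hx : Filter.Tendsto x (𝓝[{C | C.IsSymm}] Cbar) (𝓝 xbar))
    (hl : Filter.Tendsto l (𝓝[{C | C.IsSymm}] Cbar) (𝓝 lbar))
    (hsupp : ∀ᶠ C in 𝓝[{C | C.IsSymm}] Cbar, ∀ i, xbar i = 0 → x C i = 0)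
    (hfeas : ∀ᶠ C in 𝓝[{C | C.IsSymm}] Cbar, ∀ i, quad (A i) (x C) = b i)
    (hstat : ∀ᶠ C in 𝓝[{C | C.IsSymm}] Cbar,
      ∀ i, xbar i ≠ 0 → ((C - calA A (l C)) *ᵥ x C) i = 0) :
    LocallyStable k A b Cbar := by
  set F : Filter (Matrix (Fin n) (Fin n) ℝ) := 𝓝[{C | C.IsSymm}] Cbar
  have hid : Filter.Tendsto (fun C : Matrix (Fin n) (Fin n) ℝ => C) F (𝓝 Cbar) :=
    Filter.tendsto_id.mono_left nhdsWithin_le_nhds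
  have hsymm : ∀ᶠ C : Matrix (Fin n) (Fin n) ℝ in F, C.IsSymm := self_mem_nhdsWithin
  have hH : Filter.Tendsto (fun C => C - calA A (l C)) F (𝓝 (Cbar - calA A lbar)) :=
    hid.sub (((continuous_calA A).tendsto lbar).comp hl)
  have hsupp' : ∀ᶠ C in F, ∀ i, x C i = 0 ↔ xbar i = 0 := by
    have h1 : ∀ᶠ C in F, ∀ i, xbar i ≠ 0 → x C i ≠ 0 := by
      refine Filter.eventually_all.mpr fun i => ?_
      by_cases hi : xbar i = 0
      · exact Filter.Eventually.of_forall fun C h => absurd hi h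
      · filter_upwards [((tendsto_pi_nhds.mp hx) i).eventually_ne hi] with C hC _ using hC
    filter_upwards [h1, hsupp] with C hC1 hC2 i
    exact ⟨fun h => by_contra fun h' => hC1 i h' h, hC2 i⟩
  set ρ : Matrix (Fin n) (Fin n) ℝ → Fin n → ℝ := fun C => (C - calA A (l C)) *ᵥ x C
  have hρ : Filter.Tendsto ρ F (𝓝 0) := by
    rw [← hHx]
    exact ((continuous_fst.matrix_mulVec continuous_snd).tendsto
      (Cbar - calA A lbar, xbar)).comp (hH.prodMk_nhds hx)
  set z : Matrix (Fin n) (Fin n) ℝ → Fin n → ℝ := fun C => sparsityVec k (x C) (ρ C) √‖ρ C‖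
  have hz : Filter.Tendsto z F (𝓝 0) := tendsto_sparsityVec hk hx hsupp' hρ
  set Z : Matrix (Fin n) (Fin n) ℝ → Matrix (Fin n) (Fin n) ℝ :=
    fun C => Matrix.vecMulVec (z C) (z C)
  set W : Matrix (Fin n) (Fin n) ℝ → Matrix (Fin n) (Fin n) ℝ :=
    fun C => (k : ℝ) • diagPart (Z C) - Z C
  have hWcont : Continuous fun v : Fin n → ℝ =>
      (k : ℝ) • diagPart (Matrix.vecMulVec v v) - Matrix.vecMulVec v v := by
    have h := (continuous_id (X := Fin n → ℝ)).matrix_vecMulVec continuous_id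
    exact ((h.matrix_diag.matrix_diagonal).const_smul (k : ℝ)).sub h
  have hW : Filter.Tendsto W F (𝓝 0) := by
    have h : Filter.Tendsto W F (𝓝 _) := (hWcont.tendsto 0).comp hz
    have h0 : (k : ℝ) • diagPart (Matrix.vecMulVec (0 : Fin n → ℝ) 0) - Matrix.vecMulVec 0 0
        = 0 := by
      simp [diagPart]
    rwa [h0] at h
  have hcardC : ∀ᶠ C in F, hammingNorm (x C) = k := by
    filter_upwards [hsupp'] with C hC
    rw [← hcard]
    simp only [hammingNorm, ne_eq, hC]
  have hWx : ∀ᶠ C in F, W C *ᵥ x C = ρ C := by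
    filter_upwards [hcardC, hstat, hsupp'] with C hC1 hC2 hC3
    refine sparsityVec_spec hk hC1 (fun i hi => hC2 i fun h => hi ((hC3 i).mpr h)) fun h => ?_
    rwa [Real.sqrt_eq_zero (norm_nonneg _), norm_eq_zero] at h
  have hZsymm : ∀ C, (Z C).IsSymm := fun C => by
    ext i j; simp [Z, Matrix.vecMulVec_apply, mul_comm]
  have hmain := eventually_posSemidef_of_mulVec_eq_zero
    (M := fun C => C - calA A (l C) - W C) (F := F) (x := x) (x₀ := xbar)
    (M₀ := Cbar - calA A lbar) (by simpa using hH.sub hW) hx hpsd hker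
    (by
      filter_upwards [hsymm] with C hC
      exact (hC.sub (calA_isSymm hA _)).sub
        ((Matrix.IsSymm.smul (Matrix.isSymm_diagonal _) _).sub (hZsymm C)))
    (by
      filter_upwards [hWx] with C hC
      rw [Matrix.sub_mulVec, hC, sub_self])
  filter_upwards [hmain, hWx, hcardC, hfeas, hstat, hsupp'] with C h1 h2 h3 h4 h5 h6
  refine isExact_of_certificate hb (x := x C) ⟨h3.le, h4⟩ (l := l C) (Z := Z C)
    ⟨posSemidef_of_quad_nonneg (hZsymm C) fun v => ?_, h1.1⟩ ?_ ?_ h1.2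
  · rw [quad_vecMulVec]; positivity
  · change x C ⬝ᵥ (W C *ᵥ x C) = 0
    rw [h2]
    refine Finset.sum_eq_zero fun i _ => ?_
    by_cases hi : xbar i = 0
    · rw [(h6 i).mpr hi, zero_mul]
    · rw [show ρ C i = 0 from h5 i hi, mul_zero]
  · change (C - calA A (l C) - W C) *ᵥ x C = 0
    rw [Matrix.sub_mulVec, h2, sub_self]

/-! ### Lagrange multipliers on a constraint set that is a manifold -/

lemma mem_span_of_isLocalExtrOn {E : Type*} [NormedAddCommGroup E] [NormedSpace ℝ E]
    [CompleteSpace E] {ι : Type*} [Finite ι] {f : ι → E → ℝ} {f' : ι → StrongDual ℝ E}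
    {h : E → ℝ} {h' : StrongDual ℝ E} {x₀ : E}
    (hext : IsLocalExtrOn h {x | ∀ i, f i x = f i x₀} x₀)
    (hf : ∀ i, HasStrictFDerivAt (f i) (f' i) x₀) (hh : HasStrictFDerivAt h h' x₀)
    (hli : LinearIndependent ℝ f') : h' ∈ Submodule.span ℝ (Set.range f') := by
  by_contra hmem
  refine hext.linear_dependent_of_hasStrictFDerivAt hf hh ?_
  have := linearIndependent_option'.mpr ⟨hli, hmem⟩
  have heq : Option.elim' h' f' = fun o => Option.casesOn' o h' f' := by
    ext o : 1
    cases o <;> rfl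
  rw [heq]
  exact this

lemma linearIndependent_proj_comp {E : Type*} [NormedAddCommGroup E] [NormedSpace ℝ E] {c : ℕ}
    {T : E →L[ℝ] (Fin c → ℝ)} (hT : Function.Surjective T) :
    LinearIndependent ℝ fun j =>
      (ContinuousLinearMap.proj (R := ℝ) (φ := fun _ : Fin c => ℝ) j).comp T := by
  rw [Fintype.linearIndependent_iff]
  intro a ha j
  obtain ⟨v, hv⟩ := hT (Pi.single j 1)
  have h := DFunLike.congr_fun ha v
  simpa [_root_.sum_apply, hv, Pi.single_apply] using h

/-- Row rank equals column rank, for a finite family of functionals. -/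
lemma finrank_span_range_eq_finrank_range_pi {E : Type*} [NormedAddCommGroup E] [NormedSpace ℝ E]
    [FiniteDimensional ℝ E] {m : ℕ} (g' : Fin m → StrongDual ℝ E) :
    Module.finrank ℝ (Submodule.span ℝ (Set.range g'))
      = Module.finrank ℝ (LinearMap.range (ContinuousLinearMap.pi g').toLinearMap) := by
  set T : E →ₗ[ℝ] (Fin m → ℝ) := (ContinuousLinearMap.pi g').toLinearMap with hT
  rw [← LinearMap.finrank_range_dualMap_eq_finrank_range]
  let e : StrongDual ℝ E ≃ₗ[ℝ] Module.Dual ℝ E := LinearMap.toContinuousLinearMap.symm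
  rw [← e.finrank_map_eq, Submodule.map_span, ← Set.range_comp, LinearMap.range_eq_map,
    ← (Pi.basisFun ℝ (Fin m)).dualBasis.span_eq, Submodule.map_span, ← Set.range_comp]
  have h : (e ∘ g' : Fin m → Module.Dual ℝ E)
      = T.dualMap ∘ (Pi.basisFun ℝ (Fin m)).dualBasis := by
    ext i v
    simp [e, hT]
  exact congrArg (fun r => Module.finrank ℝ (Submodule.span ℝ (Set.range r))) h

/-- If the rank of the constraint Jacobian at `p` is the codimension of the manifold `M`, then
some constraint gradients, independent at `p`, serve as Lagrange multipliers at all points of `M`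
near `p`. Every constraint is constant on `M`, so the multiplier theorem for the defining
functions `φ` of `M` places all constraint gradients in the span of the differentials of `φ`, and
by dimension count the chosen gradients exhaust that span. -/
theorem exists_gradients_spanning_near {E : Type*} [NormedAddCommGroup E] [NormedSpace ℝ E]
    [FiniteDimensional ℝ E] {M : Set E} {p : E} {c m : ℕ} (hM : IsSmoothManifoldNear M p c)
    {g : Fin m → E → ℝ} {g' : Fin m → E → StrongDual ℝ E}
    (hg : ∀ i y, HasStrictFDerivAt (g i) (g' i y) y) (hg' : ∀ i, Continuous (g' i))
    (hgM : ∀ i, ∀ y ∈ M, g i y = 0)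
    (hrank : Module.finrank ℝ (Submodule.span ℝ (Set.range fun i => g' i p)) = c) :
    ∃ σ : Fin c → Fin m, LinearIndependent ℝ (fun j => g' (σ j) p) ∧
      ∀ᶠ y in 𝓝 p, y ∈ M → ∀ (h : E → ℝ) (h' : StrongDual ℝ E), HasStrictFDerivAt h h' y →
        IsLocalMinOn h M y → h' ∈ Submodule.span ℝ (Set.range fun j => g' (σ j) y) := by
  have : CompleteSpace E := FiniteDimensional.complete ℝ E
  obtain ⟨σ, hσ⟩ : ∃ σ : Fin c → Fin m, LinearIndependent ℝ (fun j => g' (σ j) p) := by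
    subst hrank
    obtain ⟨f, hf, -, hfli⟩ :=
      Submodule.exists_fun_fin_finrank_span_eq ℝ (Set.range fun i => g' i p)
    choose σ hσ using hf
    simp only at hσ
    exact ⟨σ, by simpa only [hσ] using hfli⟩
  refine ⟨σ, hσ, ?_⟩
  obtain ⟨-, U, φ, hU, hpU, hφ, hsurj, hMU⟩ := hM
  have hφ' : ContinuousAt (fderiv ℝ φ) p :=
    (hφ.continuousOn_fderiv_of_isOpen hU (by simp)).continuousAt (hU.mem_nhds hpU)
  set φ' : Fin c → E → StrongDual ℝ E := fun j y =>
    (ContinuousLinearMap.proj (R := ℝ) (φ := fun _ : Fin c => ℝ) j).comp (fderiv ℝ φ y)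
  have hφ'li : ∀ᶠ y in 𝓝 p, LinearIndependent ℝ fun j => φ' j y := by
    have hcont : ContinuousAt (fun y j => φ' j y) p :=
      continuousAt_pi.mpr fun j => continuousAt_const.clm_comp hφ'
    exact hcont.eventually (isOpen_setOfPred_linearIndependent.mem_nhds
      (linearIndependent_proj_comp hsurj))
  have hgli : ∀ᶠ y in 𝓝 p, LinearIndependent ℝ fun j => g' (σ j) y := by
    have hcont : ContinuousAt (fun y j => g' (σ j) y) p :=
      continuousAt_pi.mpr fun j => (hg' (σ j)).continuousAt
    exact hcont.eventually (isOpen_setOfPred_linearIndependent.mem_nhds hσ)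
  filter_upwards [hφ'li, hgli, hU.mem_nhds hpU] with y hy1 hy2 hyU hyM h h' hh hmin
  have hφy : φ y = 0 := by
    have : y ∈ {x ∈ U | φ x = 0} := hMU ▸ ⟨hyM, hyU⟩
    exact this.2
  have hφstrict : ∀ j, HasStrictFDerivAt (fun z => φ z j) (φ' j y) y := by
    have h1 : HasStrictFDerivAt φ (fderiv ℝ φ y) y :=
      (hφ.contDiffAt (hU.mem_nhds hyU)).hasStrictFDerivAt (by simp)
    exact fun j =>
      (ContinuousLinearMap.proj (R := ℝ) (φ := fun _ : Fin c => ℝ) j).hasStrictFDerivAt.comp y h1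
  have hspan : ∀ (h : E → ℝ) (h' : StrongDual ℝ E), HasStrictFDerivAt h h' y →
      IsLocalMinOn h M y → h' ∈ Submodule.span ℝ (Set.range fun j => φ' j y) := by
    intro h h' hh hmin
    refine mem_span_of_isLocalExtrOn (f := fun j z => φ z j) (Or.inl ?_) hφstrict hh hy1
    have h1 := eventually_nhdsWithin_iff.mp hmin
    refine eventually_nhdsWithin_iff.mpr ?_
    filter_upwards [h1, hU.mem_nhds hyU] with z hz hzU hz0
    have hz' : z ∈ M ∩ U := by
      rw [hMU]
      exact ⟨hzU, funext fun j => (hz0 j).trans (by rw [hφy])⟩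
    exact hz hz'.1
  have hle : Submodule.span ℝ (Set.range fun j => g' (σ j) y)
      ≤ Submodule.span ℝ (Set.range fun j => φ' j y) := by
    rw [Submodule.span_le]
    rintro _ ⟨j, rfl⟩
    refine hspan _ _ (hg (σ j) y) ?_
    filter_upwards [self_mem_nhdsWithin] with z hz
    rw [hgM _ y hyM, hgM _ z hz]
  rw [Submodule.eq_of_le_of_finrank_eq hle
    ((finrank_span_eq_card hy2).trans (finrank_span_eq_card hy1).symm)]
  exact hspan h h' hh hmin

/-- Coefficients with respect to a family converging to a linearly independent one tend to zero
when the linear combinations do. -/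
lemma tendsto_coeff_of_tendsto_sum {α : Type*} {l : Filter α} {E : Type*} [NormedAddCommGroup E]
    [NormedSpace ℝ E] {c : ℕ} {w : α → Fin c → E} {w₀ : Fin c → E}
    (hli : LinearIndependent ℝ w₀) (hw : Filter.Tendsto w l (𝓝 w₀)) {μ : α → Fin c → ℝ}
    (hμ : Filter.Tendsto (fun a => ∑ j, μ a j • w a j) l (𝓝 0)) : Filter.Tendsto μ l (𝓝 0) := by
  obtain ⟨K, hK, hanti⟩ := (Fintype.linearCombination ℝ w₀).exists_antilipschitzWith
    (LinearMap.ker_eq_bot.mpr (hli.fintypeLinearCombination_injective))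
  have hbound : ∀ v : Fin c → ℝ, ‖v‖ ≤ K * ‖∑ j, v j • w₀ j‖ := fun v => by
    simpa [Fintype.linearCombination_apply] using hanti.le_mul_dist v 0
  have hδ : Filter.Tendsto (fun a => ∑ j, ‖w₀ j - w a j‖) l (𝓝 0) := by
    have h1 : ∀ j, Filter.Tendsto (fun a => ‖w₀ j - w a j‖) l (𝓝 0) := fun j => by
      simpa using (((tendsto_pi_nhds.mp hw) j).const_sub (w₀ j)).norm
    simpa using tendsto_finsetSum Finset.univ fun j _ => h1 j
  have hKpos : (0 : ℝ) < K := hK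
  have hδ' : ∀ᶠ a in l, ∑ j, ‖w₀ j - w a j‖ < (2 * K : ℝ)⁻¹ :=
    hδ.eventually (gt_mem_nhds (by positivity))
  have hlim : Filter.Tendsto (fun a => 2 * (K : ℝ) * ‖∑ j, μ a j • w a j‖) l (𝓝 0) := by
    simpa using hμ.norm.const_mul (2 * (K : ℝ))
  refine squeeze_zero_norm' ?_ hlim
  filter_upwards [hδ'] with a ha
  have h1 : ‖∑ j, μ a j • w₀ j‖ ≤ ‖∑ j, μ a j • w a j‖ + ‖μ a‖ * ∑ j, ‖w₀ j - w a j‖ := by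
    have h2 : ∑ j, μ a j • w₀ j = ∑ j, μ a j • w a j + ∑ j, μ a j • (w₀ j - w a j) := by
      rw [← Finset.sum_add_distrib]
      exact Finset.sum_congr rfl fun j _ => by rw [← smul_add, add_sub_cancel]
    rw [h2]
    refine (norm_add_le _ _).trans (add_le_add le_rfl ?_)
    rw [Finset.mul_sum]
    refine (norm_sum_le _ _).trans (Finset.sum_le_sum fun j _ => ?_)
    rw [norm_smul]
    exact mul_le_mul_of_nonneg_right (norm_le_pi_norm _ _) (norm_nonneg _)
  have h3 : ‖μ a‖ * ∑ j, ‖w₀ j - w a j‖ ≤ ‖μ a‖ * (2 * K : ℝ)⁻¹ :=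
    mul_le_mul_of_nonneg_left ha.le (norm_nonneg _)
  have h4 : ‖μ a‖ ≤ K * (‖∑ j, μ a j • w a j‖ + ‖μ a‖ * (2 * K : ℝ)⁻¹) :=
    (hbound (μ a)).trans (mul_le_mul_of_nonneg_left (h1.trans (add_le_add le_rfl h3)) hKpos.le)
  have h5 : (K : ℝ) * (‖μ a‖ * (2 * K : ℝ)⁻¹) = ‖μ a‖ / 2 := by field_simp
  rw [mul_add, h5] at h4
  linarith

/-! ### The problem restricted to a coordinate subspace -/

/-- Extension by zero as a continuous linear map. -/
noncomputable def extendZeroL {n : ℕ} (S : Finset (Fin n)) : (S → ℝ) →L[ℝ] (Fin n → ℝ) :=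
  LinearMap.toContinuousLinearMap
    { toFun := extendZero S
      map_add' := fun x y => by
        ext i; by_cases h : i ∈ S <;> simp [extendZero, h]
      map_smul' := fun c x => by
        ext i; by_cases h : i ∈ S <;> simp [extendZero, h] }

lemma extendZeroL_apply {n : ℕ} (S : Finset (Fin n)) (y : S → ℝ) :
    extendZeroL S y = extendZero S y := rfl

lemma continuous_extendZero {n : ℕ} (S : Finset (Fin n)) : Continuous (extendZero S) :=
  (extendZeroL S).continuous

lemma extendZero_restrictTo_supp {n : ℕ} (x : Fin n → ℝ) :
    extendZero (supp x) (restrictTo (supp x) x) = x := by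
  ext i
  by_cases h : i ∈ supp x
  · simp [extendZero, restrictTo, h]
  · have h0 : x i = 0 := by simpa [supp] using h
    simp [extendZero, h, h0]

lemma extendZero_single {n : ℕ} (S : Finset (Fin n)) (i : S) :
    extendZero S (Pi.single i 1) = Pi.single (i : Fin n) 1 := by
  ext j
  by_cases h : j ∈ S
  · simp [extendZero, h, Pi.single_apply, Subtype.ext_iff]
  · have hne : j ≠ i := fun h' => h (h' ▸ i.2)
    simp [extendZero, h, hne]

/-- The differential at `y` of `xᵀ M x` restricted to the coordinate subspace `ℝ^S`
(for symmetric `M`), namely `v ↦ 2 (M y)ᵀ v`. -/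
noncomputable def gradQuad {n : ℕ} (S : Finset (Fin n)) (M : Matrix (Fin n) (Fin n) ℝ)
    (y : S → ℝ) : StrongDual ℝ (S → ℝ) :=
  (∑ i, (2 * (M *ᵥ extendZero S y) i) •
    (ContinuousLinearMap.proj i : (Fin n → ℝ) →L[ℝ] ℝ)).comp (extendZeroL S)

lemma gradQuad_apply {n : ℕ} (S : Finset (Fin n)) (M : Matrix (Fin n) (Fin n) ℝ)
    (y v : S → ℝ) :
    gradQuad S M y v = 2 * ((M *ᵥ extendZero S y) ⬝ᵥ extendZero S v) := by
  simp [gradQuad, _root_.sum_apply, extendZeroL_apply, dotProduct, Finset.mul_sum, mul_assoc]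

lemma continuous_gradQuad {n : ℕ} (S : Finset (Fin n)) :
    Continuous fun q : Matrix (Fin n) (Fin n) ℝ × (S → ℝ) => gradQuad S q.1 q.2 := by
  have h : Continuous fun q : Matrix (Fin n) (Fin n) ℝ × (S → ℝ) =>
      q.1 *ᵥ extendZero S q.2 :=
    continuous_fst.matrix_mulVec ((continuous_extendZero S).comp continuous_snd)
  refine Continuous.clm_comp (continuous_finsetSum _ fun i _ => ?_) continuous_const
  exact (continuous_const.mul ((continuous_apply i).comp h)).smul continuous_const

-- From here on `gradQuad` is used only through its evaluation and continuity lemmas.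
attribute [irreducible] gradQuad

lemma hasStrictFDerivAt_quad_extendZero {n : ℕ} (S : Finset (Fin n))
    {M : Matrix (Fin n) (Fin n) ℝ} (hM : M.IsSymm) (y : S → ℝ) :
    HasStrictFDerivAt (fun y => quad M (extendZero S y)) (gradQuad S M y) y := by
  have hp : ∀ i, HasStrictFDerivAt (fun y : S → ℝ => extendZero S y i)
      ((ContinuousLinearMap.proj i : (Fin n → ℝ) →L[ℝ] ℝ).comp (extendZeroL S)) y := fun i =>
    ((ContinuousLinearMap.proj i : (Fin n → ℝ) →L[ℝ] ℝ).comp (extendZeroL S)).hasStrictFDerivAt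
  have h := HasStrictFDerivAt.fun_sum (u := Finset.univ) fun i _ =>
    (hp i).mul (HasStrictFDerivAt.fun_sum (u := Finset.univ) fun j _ => (hp j).const_mul (M i j))
  refine h.congr_fderiv ?_
  ext v
  have h1 : (M *ᵥ extendZero S y) ⬝ᵥ extendZero S v
      = extendZero S y ⬝ᵥ (M *ᵥ extendZero S v) := by
    rw [Matrix.dotProduct_mulVec, ← Matrix.mulVec_transpose, hM.eq]
  rw [gradQuad_apply, two_mul]
  nth_rewrite 1 [h1]
  simp [_root_.sum_apply, extendZeroL_apply, dotProduct, Matrix.mulVec,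
    Finset.sum_add_distrib, mul_comm]

lemma gradQuad_sub {n : ℕ} (S : Finset (Fin n)) (M N : Matrix (Fin n) (Fin n) ℝ)
    (y : S → ℝ) : gradQuad S (M - N) y = gradQuad S M y - gradQuad S N y := by
  ext v
  simp [gradQuad_apply, Matrix.sub_mulVec, sub_dotProduct, mul_sub]

lemma gradQuad_sum_smul {n c : ℕ} (S : Finset (Fin n)) (μ : Fin c → ℝ)
    (M : Fin c → Matrix (Fin n) (Fin n) ℝ) (y : S → ℝ) :
    gradQuad S (∑ j, μ j • M j) y = ∑ j, μ j • gradQuad S (M j) y := by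
  ext v
  simp only [gradQuad_apply, Matrix.sum_mulVec, Matrix.smul_mulVec, sum_dotProduct,
    smul_dotProduct, _root_.sum_apply, _root_.smul_apply, smul_eq_mul, Finset.mul_sum]
  exact Finset.sum_congr rfl fun j _ => by ring

lemma mulVec_apply_eq_zero_of_gradQuad_eq_zero {n : ℕ} {S : Finset (Fin n)}
    {M : Matrix (Fin n) (Fin n) ℝ} {y : S → ℝ} (h : gradQuad S M y = 0) {i : Fin n}
    (hi : i ∈ S) : (M *ᵥ extendZero S y) i = 0 := by
  have h1 : gradQuad S M y (Pi.single ⟨i, hi⟩ 1) = 0 := by rw [h]; rfl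
  rw [gradQuad_apply, extendZero_single] at h1
  simpa using h1

lemma isClosed_suppVariety {n m : ℕ} (A : Fin m → Matrix (Fin n) (Fin n) ℝ) (b : Fin m → ℝ)
    (S : Finset (Fin n)) : IsClosed (suppVariety A b S) := by
  have h1 : Continuous (constraintMap A b) := continuous_pi fun i =>
    (continuous_quad.comp (continuous_const.prodMk continuous_id)).sub continuous_const
  refine (isClosed_eq h1 continuous_const).inter ?_
  have h2 : {x : Fin n → ℝ | ∀ i ∉ S, x i = 0} = ⋂ i, ⋂ (_ : i ∉ S), {x | x i = 0} := by
    ext x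
    simp
  change IsClosed {x : Fin n → ℝ | ∀ i ∉ S, x i = 0}
  rw [h2]
  exact isClosed_iInter fun i => isClosed_iInter fun _ =>
    isClosed_eq (continuous_apply i) continuous_const

lemma mem_preimage_suppVariety_iff {n m : ℕ} {A : Fin m → Matrix (Fin n) (Fin n) ℝ}
    {b : Fin m → ℝ} {S : Finset (Fin n)} {y : S → ℝ} :
    y ∈ extendZero S ⁻¹' suppVariety A b S ↔ ∀ i, quad (A i) (extendZero S y) = b i := by
  constructor
  · intro h i
    exact sub_eq_zero.mp (congrFun h.1 i)
  · intro h
    refine ⟨funext fun i => sub_eq_zero.mpr (h i), fun i hi => ?_⟩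
    simp [extendZero, hi]

/-- Under the Abadie constraint qualification the constraint gradients at `x` span a space of
dimension the codimension of the variety. -/
lemma finrank_span_gradQuad {n m c : ℕ} {A : Fin m → Matrix (Fin n) (Fin n) ℝ}
    (hA : ∀ i, (A i).IsSymm) {b : Fin m → ℝ} {S : Finset (Fin n)} {p : S → ℝ}
    (h : (fderiv ℝ (fun y => constraintMap A b (extendZero S y)) p).rank = c) :
    Module.finrank ℝ (Submodule.span ℝ (Set.range fun i => gradQuad S (A i) p)) = c := by
  have h1 : HasStrictFDerivAt (fun y => constraintMap A b (extendZero S y))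
      (ContinuousLinearMap.pi fun i => gradQuad S (A i) p) p :=
    hasStrictFDerivAt_pi.2 fun i => (hasStrictFDerivAt_quad_extendZero S (hA i) p).sub_const (b i)
  rw [h1.hasFDerivAt.fderiv] at h
  rw [finrank_span_range_eq_finrank_range_pi]
  exact Module.finrank_eq_of_rank_eq h

/-! ### Stability of minimizers -/

/-- Minimizers over a compact set of a jointly continuous function converge when the limiting
function has a unique minimizer. -/
lemma tendsto_of_isMinOn {X Y : Type*} [TopologicalSpace X] [TopologicalSpace Y]
    {f : X → Y → ℝ} (hf : Continuous fun q : X × Y => f q.1 q.2) {K : Set Y} (hK : IsCompact K)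
    {x₀ : X} {y₀ : Y} (hy₀ : y₀ ∈ K) (huniq : ∀ y ∈ K, f x₀ y ≤ f x₀ y₀ → y = y₀)
    {y : X → Y} (hyK : ∀ x, y x ∈ K) (hmin : ∀ x, IsMinOn (f x) K (y x)) :
    Filter.Tendsto y (𝓝 x₀) (𝓝 y₀) := by
  refine hK.tendsto_nhds_of_unique_mapClusterPt (Filter.Eventually.of_forall hyK) fun v hv hc => ?_
  obtain ⟨U, hU, hUv⟩ := mapClusterPt_iff_ultrafilter.mp hc
  have hid : Filter.Tendsto (fun x : X => x) U (𝓝 x₀) := hU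
  refine huniq v hv (le_of_tendsto_of_tendsto
    ((hf.tendsto (x₀, v)).comp (hid.prodMk_nhds hUv))
    ((hf.tendsto (x₀, y₀)).comp (hid.prodMk_nhds tendsto_const_nhds))
    (Filter.Eventually.of_forall fun x => hmin x hy₀))

lemma extendZero_injective {n : ℕ} (S : Finset (Fin n)) :
    Function.Injective (extendZero S) := by
  intro u v h
  ext i
  simpa [extendZero] using congrFun h (i : Fin n)

/-- Minimizing the Lagrangian over the part of the variety in a ball around `p`, for objectives
near `Cbar`, yields local minimizers on the variety that converge to `p`. The radius of the ball is
chosen to exclude `-p`, the only other minimizer at `Cbar`. -/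
theorem exists_tendsto_localMin {n m : ℕ} {A : Fin m → Matrix (Fin n) (Fin n) ℝ}
    {b : Fin m → ℝ} (hb : ∃ i, b i ≠ 0) {H₀ B : Matrix (Fin n) (Fin n) ℝ} {S : Finset (Fin n)}
    {p : S → ℝ} (hfeas : ∀ i, quad (A i) (extendZero S p) = b i)
    (hpsd : (H₀ - B).PosSemidef) (hHx : (H₀ - B) *ᵥ extendZero S p = 0)
    (hker : ∀ v, (H₀ - B) *ᵥ v = 0 → ∃ s : ℝ, s • extendZero S p = v) :
    ∃ y : Matrix (Fin n) (Fin n) ℝ → S → ℝ, Filter.Tendsto y (𝓝 H₀) (𝓝 p) ∧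
      (∀ C, y C ∈ extendZero S ⁻¹' suppVariety A b S) ∧
      ∀ᶠ C in 𝓝 H₀, IsLocalMinOn (fun u => quad (C - B) (extendZero S u))
        (extendZero S ⁻¹' suppVariety A b S) (y C) := by
  have hpM : p ∈ extendZero S ⁻¹' suppVariety A b S := mem_preimage_suppVariety_iff.mpr hfeas
  have hp0 : p ≠ 0 := by
    rintro rfl
    obtain ⟨i, hi⟩ := hb
    have h0 : extendZero S 0 = 0 := (extendZeroL S).map_zero
    apply hi
    rw [← hfeas i, h0]
    simp [quad]
  have hpnorm : 0 < ‖p‖ := norm_pos_iff.mpr hp0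
  have hK : IsCompact (extendZero S ⁻¹' suppVariety A b S ∩ Metric.closedBall p ‖p‖) :=
    (isCompact_closedBall p ‖p‖).inter_left
      ((isClosed_suppVariety A b S).preimage (continuous_extendZero S))
  have hpK : p ∈ extendZero S ⁻¹' suppVariety A b S ∩ Metric.closedBall p ‖p‖ :=
    ⟨hpM, Metric.mem_closedBall_self hpnorm.le⟩
  have hfcont : Continuous fun q : Matrix (Fin n) (Fin n) ℝ × (S → ℝ) =>
      quad (q.1 - B) (extendZero S q.2) :=
    continuous_quad.comp ((continuous_fst.sub continuous_const).prodMk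
      ((continuous_extendZero S).comp continuous_snd))
  have hex : ∀ C, ∃ y ∈ extendZero S ⁻¹' suppVariety A b S ∩ Metric.closedBall p ‖p‖,
      IsMinOn (fun u => quad (C - B) (extendZero S u))
        (extendZero S ⁻¹' suppVariety A b S ∩ Metric.closedBall p ‖p‖) y := fun C =>
    hK.exists_isMinOn ⟨p, hpK⟩
      (hfcont.comp (continuous_const.prodMk continuous_id)).continuousOn
  choose y hyK hymin using hex
  have huniq : ∀ u ∈ extendZero S ⁻¹' suppVariety A b S ∩ Metric.closedBall p ‖p‖,
      quad (H₀ - B) (extendZero S u) ≤ quad (H₀ - B) (extendZero S p) → u = p := by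
    rintro u ⟨huM, hu⟩ hle
    rw [(hpsd.quad_eq_zero_iff _).mpr hHx] at hle
    obtain ⟨s, hs⟩ := hker _ ((hpsd.quad_eq_zero_iff _).mp
      (le_antisymm hle (hpsd.quad_nonneg _)))
    have hu' : u = s • p := extendZero_injective S (by
      rw [← hs]
      exact ((extendZeroL S).map_smul s p).symm)
    obtain ⟨i, hi⟩ := hb
    have h2 := mem_preimage_suppVariety_iff.mp huM i
    rw [← hs, quad_smul, hfeas i] at h2
    have h3 : s ^ 2 = 1 := mul_right_cancel₀ hi (by rw [h2, one_mul])
    -- The case `s = -1` is excluded because `-p` has distance `2 ‖p‖` from `p`.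
    rcases (sq_eq_sq_iff_eq_or_eq_neg.mp (h3.trans (one_pow 2).symm)) with h4 | h4
    · rw [hu', h4, one_smul]
    · exfalso
      rw [Metric.mem_closedBall, dist_eq_norm, hu', h4,
        show (-1 : ℝ) • p - p = (-2 : ℝ) • p by rw [neg_one_smul, neg_smul, two_smul]; abel,
        norm_smul] at hu
      norm_num at hu
      linarith
  have hytend : Filter.Tendsto y (𝓝 H₀) (𝓝 p) :=
    tendsto_of_isMinOn (f := fun C u => quad (C - B) (extendZero S u)) hfcont hK hpK huniq
      hyK hymin
  refine ⟨y, hytend, fun C => (hyK C).1, ?_⟩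
  filter_upwards [hytend.eventually (Metric.ball_mem_nhds p hpnorm)] with C hball
  refine eventually_nhdsWithin_iff.mpr ?_
  filter_upwards [Metric.isOpen_ball.mem_nhds hball] with u hu huM
  exact hymin C ⟨huM, Metric.ball_subset_closedBall hu⟩

/-- `exists_gradients_spanning_near` for the quadratic constraints on `ℝ^S`. -/
lemma exists_gradQuad_spanning_near {n m c : ℕ}
    {A : Fin m → Matrix (Fin n) (Fin n) ℝ} (hA : ∀ i, (A i).IsSymm) {b : Fin m → ℝ}
    {S : Finset (Fin n)} {p : S → ℝ}
    (hM : IsSmoothManifoldNear (extendZero S ⁻¹' suppVariety A b S) p c)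
    (hrank : (fderiv ℝ (fun y => constraintMap A b (extendZero S y)) p).rank = c) :
    ∃ σ : Fin c → Fin m, LinearIndependent ℝ (fun j => gradQuad S (A (σ j)) p) ∧
      ∀ᶠ y in 𝓝 p, y ∈ extendZero S ⁻¹' suppVariety A b S →
        ∀ M : Matrix (Fin n) (Fin n) ℝ, M.IsSymm →
        IsLocalMinOn (fun u => quad M (extendZero S u)) (extendZero S ⁻¹' suppVariety A b S) y →
        ∃ μ : Fin c → ℝ, ∑ j, μ j • gradQuad S (A (σ j)) y = gradQuad S M y := by
  have hg : ∀ i (y : S → ℝ), HasStrictFDerivAt (fun y => quad (A i) (extendZero S y) - b i)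
      (gradQuad S (A i) y) y :=
    fun i y => (hasStrictFDerivAt_quad_extendZero S (hA i) y).sub_const _
  have hg' : ∀ i, Continuous (gradQuad S (A i)) :=
    fun i => (continuous_gradQuad S).comp (continuous_const.prodMk continuous_id)
  have hgM : ∀ i, ∀ y ∈ extendZero S ⁻¹' suppVariety A b S,
      quad (A i) (extendZero S y) - b i = 0 :=
    fun i y hy => sub_eq_zero.mpr (mem_preimage_suppVariety_iff.mp hy i)
  obtain ⟨σ, hσ, hspan⟩ := exists_gradients_spanning_near hM hg hg' hgM
    (finrank_span_gradQuad hA hrank)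
  refine ⟨σ, hσ, ?_⟩
  filter_upwards [hspan] with y hy hyM M hMs hmin
  exact (Submodule.mem_span_range_iff_exists_fun ℝ).mp
    (hy hyM _ _ (hasStrictFDerivAt_quad_extendZero S hMs y) hmin)

/-- The local minimizers of the Lagrangian have multipliers `μ` on a subfamily of the constraints
whose gradients stay linearly independent; `μ` tends to zero because the gradient of the Lagrangian
does. -/
theorem exists_tendsto_multipliers_of_localMin {n m c : ℕ}
    {A : Fin m → Matrix (Fin n) (Fin n) ℝ} (hA : ∀ i, (A i).IsSymm) {b : Fin m → ℝ}
    {H₀ B : Matrix (Fin n) (Fin n) ℝ} (hB : B.IsSymm) {S : Finset (Fin n)} {p : S → ℝ}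
    (hHx : (H₀ - B) *ᵥ extendZero S p = 0)
    (hM : IsSmoothManifoldNear (extendZero S ⁻¹' suppVariety A b S) p c)
    (hrank : (fderiv ℝ (fun y => constraintMap A b (extendZero S y)) p).rank = c)
    {y : Matrix (Fin n) (Fin n) ℝ → S → ℝ} (hy : Filter.Tendsto y (𝓝 H₀) (𝓝 p))
    (hyM : ∀ C, y C ∈ extendZero S ⁻¹' suppVariety A b S)
    (hmin : ∀ᶠ C in 𝓝 H₀, IsLocalMinOn (fun u => quad (C - B) (extendZero S u))
        (extendZero S ⁻¹' suppVariety A b S) (y C)) :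
    ∃ (σ : Fin c → Fin m) (μ : Matrix (Fin n) (Fin n) ℝ → Fin c → ℝ),
      Filter.Tendsto μ (𝓝[{C | C.IsSymm}] H₀) (𝓝 0) ∧ ∀ᶠ C in 𝓝[{C | C.IsSymm}] H₀,
        gradQuad S (C - B - ∑ j, μ C j • A (σ j)) (y C) = 0 := by
  have hFle : 𝓝[{C : Matrix (Fin n) (Fin n) ℝ | C.IsSymm}] H₀ ≤ 𝓝 H₀ := nhdsWithin_le_nhds
  obtain ⟨σ, hσ, hspan⟩ := exists_gradQuad_spanning_near hA hM hrank
  have hmult : ∀ᶠ C in 𝓝[{C : Matrix (Fin n) (Fin n) ℝ | C.IsSymm}] H₀, ∃ μ : Fin c → ℝ,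
      ∑ j, μ j • gradQuad S (A (σ j)) (y C) = gradQuad S (C - B) (y C) := by
    filter_upwards [hFle (hy.eventually hspan), self_mem_nhdsWithin, hFle hmin]
      with C hC hsymm hmC
    exact hC (hyM C) _ (Matrix.IsSymm.sub hsymm hB) hmC
  obtain ⟨μ, hμ⟩ : ∃ μ : Matrix (Fin n) (Fin n) ℝ → Fin c → ℝ,
      ∀ᶠ C in 𝓝[{C : Matrix (Fin n) (Fin n) ℝ | C.IsSymm}] H₀,
        ∑ j, μ C j • gradQuad S (A (σ j)) (y C) = gradQuad S (C - B) (y C) :=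
    Filter.skolem.mp hmult
  have hid : Filter.Tendsto (fun C : Matrix (Fin n) (Fin n) ℝ => C)
    (𝓝[{C : Matrix (Fin n) (Fin n) ℝ | C.IsSymm}] H₀) (𝓝 H₀) := hFle
  have hytend := hy.mono_left hFle
  have hgrad : Filter.Tendsto (fun C => gradQuad S (C - B) (y C))
      (𝓝[{C : Matrix (Fin n) (Fin n) ℝ | C.IsSymm}] H₀) (𝓝 0) := by
    have h0 : gradQuad S (H₀ - B) p = 0 := by
      ext v
      simp [gradQuad_apply, hHx]
    rw [← h0]
    exact ((continuous_gradQuad S).tendsto (H₀ - B, p)).comp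
      ((hid.sub tendsto_const_nhds).prodMk_nhds hytend)
  refine ⟨σ, μ, ?_, ?_⟩
  · refine tendsto_coeff_of_tendsto_sum (w := fun C j => gradQuad S (A (σ j)) (y C)) hσ
      (tendsto_pi_nhds.mpr fun j => ?_) (hgrad.congr' ?_)
    · exact ((continuous_gradQuad S).tendsto (A (σ j), p)).comp
        (tendsto_const_nhds.prodMk_nhds hytend)
    · filter_upwards [hμ] with C hC using hC.symm
  · filter_upwards [hμ] with C hC
    rw [gradQuad_sub, gradQuad_sum_smul, hC, sub_self]

/-- For objectives near `Cbar` there are critical points and multipliers of the problem restricted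
to the support of `xbar`, converging to `(xbar, lbar)`. -/
theorem exists_tendsto_multipliers {n m : ℕ} {A : Fin m → Matrix (Fin n) (Fin n) ℝ}
    (hA : ∀ i, (A i).IsSymm) {b : Fin m → ℝ} (hb : ∃ i, b i ≠ 0)
    {Cbar : Matrix (Fin n) (Fin n) ℝ} {xbar : Fin n → ℝ} {lbar : Fin m → ℝ}
    (hfeas : ∀ i, quad (A i) xbar = b i)
    (hpsd : (Cbar - calA A lbar).PosSemidef)
    (hHx : (Cbar - calA A lbar) *ᵥ xbar = 0)
    (hker : ∀ v, (Cbar - calA A lbar) *ᵥ v = 0 → ∃ s : ℝ, s • xbar = v)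
    (hACQ : ACQ A b xbar) :
    ∃ (x : Matrix (Fin n) (Fin n) ℝ → Fin n → ℝ) (l : Matrix (Fin n) (Fin n) ℝ → Fin m → ℝ),
      Filter.Tendsto x (𝓝[{C | C.IsSymm}] Cbar) (𝓝 xbar) ∧
      Filter.Tendsto l (𝓝[{C | C.IsSymm}] Cbar) (𝓝 lbar) ∧
      ∀ᶠ C in 𝓝[{C | C.IsSymm}] Cbar,
        (∀ i, xbar i = 0 → x C i = 0) ∧ (∀ i, quad (A i) (x C) = b i) ∧
          ∀ i, xbar i ≠ 0 → ((C - calA A (l C)) *ᵥ x C) i = 0 := by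
  obtain ⟨c, hM, hrank⟩ := hACQ
  have hep := extendZero_restrictTo_supp xbar
  obtain ⟨y, hytend, hyM, hmin⟩ := exists_tendsto_localMin (A := A) hb
    (p := restrictTo (supp xbar) xbar) (by rwa [hep]) hpsd (by rwa [hep]) (by rwa [hep])
  obtain ⟨σ, μ, hμtend, hμ⟩ := exists_tendsto_multipliers_of_localMin hA (calA_isSymm hA lbar)
    (by rwa [hep]) hM hrank hytend hyM hmin
  refine ⟨fun C => extendZero (supp xbar) (y C),
    fun C => lbar + ∑ j, μ C j • Pi.single (σ j) (1 : ℝ), ?_, ?_, ?_⟩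
  · have h := ((continuous_extendZero (supp xbar)).tendsto _).comp
      (hytend.mono_left
        (nhdsWithin_le_nhds (s := {C : Matrix (Fin n) (Fin n) ℝ | C.IsSymm})))
    rwa [hep] at h
  · have h1 : Continuous fun v : Fin c → ℝ =>
        lbar + ∑ j, v j • (Pi.single (σ j) (1 : ℝ) : Fin m → ℝ) :=
      continuous_const.add (continuous_finsetSum _ fun j _ =>
        (continuous_apply j).smul continuous_const)
    have h2 := (h1.tendsto 0).comp hμtend
    simp only [Pi.zero_apply, zero_smul, Finset.sum_const_zero, add_zero] at h2
    exact h2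
  · filter_upwards [hμ] with C hC
    refine ⟨fun i hi => ?_, mem_preimage_suppVariety_iff.mp (hyM C), fun i hi => ?_⟩
    · have : i ∉ supp xbar := by simp [supp, hi]
      simp [extendZero, this]
    · refine mulVec_apply_eq_zero_of_gradQuad_eq_zero ?_ (by simp [supp, hi])
      have h1 : calA A (lbar + ∑ j, μ C j • Pi.single (σ j) (1 : ℝ))
          = calA A lbar + ∑ j, μ C j • A (σ j) := by
        simp only [calA, Pi.add_apply, Finset.sum_apply, Pi.smul_apply, smul_eq_mul, add_smul,
          Finset.sum_add_distrib, Finset.sum_smul]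
        rw [Finset.sum_comm]
        simp [Pi.single_apply]
      rw [h1, ← sub_sub]
      exact hC

/-! ### Consequences of strong duality -/

lemma quad_eq_dotProduct_of_valD_eq_valP {n m k : ℕ} {A : Fin m → Matrix (Fin n) (Fin n) ℝ}
    {b : Fin m → ℝ} {C : Matrix (Fin n) (Fin n) ℝ} {x : Fin n → ℝ} {l : Fin m → ℝ}
    {Z : Matrix (Fin n) (Fin n) ℝ} (hx : IsOptP k A b C x) (hl : IsOptD k A b C l Z)
    (h : valD k A b C = valP k A b C) : l ⬝ᵥ b = quad C x := by
  have hD : valD k A b C = ((l ⬝ᵥ b : ℝ) : EReal) :=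
    le_antisymm (iSup₂_le fun q hq => EReal.coe_le_coe (hl.2 q hq))
      (le_iSup₂ (f := fun q (_ : q ∈ feasD k A C) => ((q.1 ⬝ᵥ b : ℝ) : EReal)) (l, Z) hl.1)
  have hP : valP k A b C = ((quad C x : ℝ) : EReal) :=
    le_antisymm (iInf₂_le x hx.1) (le_iInf₂ fun y hy => EReal.coe_le_coe (hx.2 y hy))
  rw [hD, hP] at h
  exact EReal.coe_injective h

lemma exists_smul_eq_of_rank_add_one_eq {n : ℕ} {M : Matrix (Fin n) (Fin n) ℝ}
    (hM : M.rank + 1 = n) {x : Fin n → ℝ} (hx : x ≠ 0) (hMx : M *ᵥ x = 0) {v : Fin n → ℝ}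
    (hv : M *ᵥ v = 0) : ∃ s : ℝ, s • x = v := by
  have h1 := LinearMap.finrank_range_add_finrank_ker M.mulVecLin
  have h2 : Module.finrank ℝ (LinearMap.ker M.mulVecLin) = 1 := by
    simp only [Module.finrank_fin_fun] at h1
    change M.rank + _ = n at h1
    omega
  obtain ⟨s, hs⟩ := (finrank_eq_one_iff_of_nonzero' (⟨x, hMx⟩ : LinearMap.ker M.mulVecLin)
    (fun h => hx (congrArg Subtype.val h))).mp h2 ⟨v, hv⟩
  exact ⟨s, congrArg Subtype.val hs⟩

end SparseQCQP

theorem mainTheorem3 {n m k : ℕ}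
    (A : Fin m → Matrix (Fin n) (Fin n) ℝ) (hA : ∀ i, (A i).IsSymm)
    (b : Fin m → ℝ) (hb : ∃ i, b i ≠ 0)
    (Cbar : Matrix (Fin n) (Fin n) ℝ) (hC : Cbar.IsSymm)
    (hDQ : SparseQCQP.valD k A b Cbar = SparseQCQP.valQ k A b Cbar)
    (hQP : SparseQCQP.valQ k A b Cbar = SparseQCQP.valP k A b Cbar)
    (xbar : Fin n → ℝ) (hx : SparseQCQP.IsOptP k A b Cbar xbar)
    (lbar : Fin m → ℝ) (Zbar : Matrix (Fin n) (Fin n) ℝ)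
    (hlZ : SparseQCQP.IsOptD k A b Cbar lbar Zbar)
    (hcard : hammingNorm xbar = k)
    (hACQ : SparseQCQP.ACQ A b xbar)
    (hZ : Zbar = 0)
    (hcorank : (Cbar - SparseQCQP.calA A lbar).rank + 1 = n) :
    SparseQCQP.LocallyStable k A b Cbar := by
  have hx0 : xbar ≠ 0 := by
    rintro rfl
    obtain ⟨i, hi⟩ := hb
    apply hi
    rw [← hx.1.2 i]
    simp [SparseQCQP.quad]
  have hk : k ≠ 0 := by
    rw [← hcard]
    simpa using hx0
  have hval := SparseQCQP.quad_eq_dotProduct_of_valD_eq_valP hx hlZ (hDQ.trans hQP)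
  have hpsd : (Cbar - SparseQCQP.calA A lbar).PosSemidef := by
    simpa [hZ, SparseQCQP.diagPart] using hlZ.1.2
  -- Complementary slackness: the Lagrangian vanishes at `xbar` by strong duality.
  have hHx : (Cbar - SparseQCQP.calA A lbar) *ᵥ xbar = 0 := by
    rw [← hpsd.quad_eq_zero_iff, SparseQCQP.quad_sub, SparseQCQP.quad_calA, ← hval]
    simp [hx.1.2, dotProduct]
  have hker : ∀ v, (Cbar - SparseQCQP.calA A lbar) *ᵥ v = 0 → ∃ s : ℝ, s • xbar = v :=
    fun v hv => SparseQCQP.exists_smul_eq_of_rank_add_one_eq hcorank hx0 hHx hv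
  obtain ⟨x, l, hxt, hlt, hev⟩ :=
    SparseQCQP.exists_tendsto_multipliers hA hb hx.1.2 hpsd hHx hker hACQ
  exact SparseQCQP.locallyStable_of_tendsto hA hb hk hcard hpsd hHx hker hxt hlt
    (hev.mono fun C h => h.1) (hev.mono fun _ h => h.2.1) (hev.mono fun C h => h.2.2)
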